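/- All graphs are finite and simple. Let $G$ be a graph with no universal vertex, i.e. $N_G[v]\neq V(G)$ for every vertex $v$, where $N_G[v]=\{v\}\cup\{w : vw\in E(G)\}$. For a clique $K$ of $G$ (a possibly empty, not necessarily maximal set of pairwise adjacent vertices), let $G^K$ be the graph with vertex set $V(G)$ in which two distinct vertices are adjacent according to the following rules: - $u,u'\in V(G)\setminus K$ are adjacent in $G^K$ if and only if $uu'\in E(G)$; - $v,v'\in K$ are adjacent in $G^K$ if and only if $N_G[v]\cup N_G[v']\neq V(G)$ or $vv'$ is an edge of an induced cycle on four vertices of $G$; - $v\in K$ and $u\in V(G)\setminus K$ are adjacent in $G^K$ if and only if $uv\notin E(G)$, or $uv\in E(G)$ and $N_G[u]\not\subseteq N_G[v]$. An interval model of a graph $H$ assigns to each vertex $x$ a nonempty closed interval $I(x)=[\mathrm{lp}(x),\mathrm{rp}(x)]$ of the real line so that two distinct vertices are adjacent in $H$ if and only if their intervals intersect. The interval $I(v)$ doubly extends $I(u)$ if $\mathrm{lp}(v)<\mathrm{lp}(u)\le \mathrm{rp}(u)<\mathrm{rp}(v)$. A graph is a circular-arc graph if one can assign to each vertex a closed arc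 of a circle so that two distinct vertices are adjacent if and only if their arcs intersect. Then $G$ is a circular-arc graph if and only if there is a clique $K$ of $G$ such that $G^K$ satisfies the following condition. $(\sharp)$ $G^K$ admits an interval model in which, for all $v\in K$ and $u\in V(G)\setminus K$, the interval of $v$ doubly extends the interval of $u$ if and only if $uv\notin E(G)$. -/

import Mathlib

namespace CircArc

/-- The closed neighbourhood `N[v] = N(v) ∪ {v}`. -/
def closedNbhd {V : Type*} (G : SimpleGraph V) (v : V) : Set V :=
  insert v (G.neighborSet v)

/-- The closed arc of the circle `ℝ / ℤ` that runs in the positive direction from (the image of)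
`a` to (the image of) `b`; used for `a ≤ b < a + 1`. -/
def arc (a b : ℝ) : Set UnitAddCircle :=
  (fun x : ℝ => (x : UnitAddCircle)) '' Set.Icc a b

/-- A set of points of the circle is a closed arc; single points are allowed,
and the whole circle is not an arc. -/
def IsArc (S : Set UnitAddCircle) : Prop :=
  ∃ a b : ℝ, a ≤ b ∧ b < a + 1 ∧ S = arc a b

/-- `G` is a circular-arc graph: it is the intersection graph of a family of arcs of a circle. -/
def IsCircularArcGraph {V : Type*} (G : SimpleGraph V) : Prop :=
  ∃ A : V → Set UnitAddCircle, (∀ v, IsArc (A v)) ∧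
    ∀ u v, u ≠ v → (G.Adj u v ↔ (A u ∩ A v).Nonempty)

/-- An interval model of `H`: an assignment of nonempty closed real intervals `[lp v, rp v]` to
the vertices such that distinct vertices are adjacent iff their intervals intersect. -/
structure IntervalModel {V : Type*} (H : SimpleGraph V) where
  lp : V → ℝ
  rp : V → ℝ
  lp_le_rp : ∀ v, lp v ≤ rp v
  adj_iff : ∀ u v, u ≠ v →
    (H.Adj u v ↔ (Set.Icc (lp u) (rp u) ∩ Set.Icc (lp v) (rp v)).Nonempty)

/-- The interval of `v` doubly extends the interval of `u`. -/
def IntervalModel.DoublyExtends {V : Type*} {H : SimpleGraph V} (I : IntervalModel H)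
    (v u : V) : Prop :=
  I.lp v < I.lp u ∧ I.lp u ≤ I.rp u ∧ I.rp u < I.rp v

/-- `vv'` is an edge of an induced cycle `v v' w w'` on four vertices of `G`. -/
def IsEdgeOfC4 {V : Type*} (G : SimpleGraph V) (v v' : V) : Prop :=
  ∃ w w' : V, v ≠ w ∧ v' ≠ w' ∧
    G.Adj v v' ∧ G.Adj v' w ∧ G.Adj w w' ∧ G.Adj w' v ∧ ¬ G.Adj v w ∧ ¬ G.Adj v' w'

theorem IsEdgeOfC4.symm {V : Type*} {G : SimpleGraph V} {v v' : V}
    (h : IsEdgeOfC4 G v v') : IsEdgeOfC4 G v' v := by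
  obtain ⟨w, w', h1, h2, h3, h4, h5, h6, h7, h8⟩ := h
  exact ⟨w', w, h2, h1, h3.symm, h6.symm, h5.symm, h4.symm, h8, h7⟩

/-- The auxiliary graph `G^K` on the vertex set of `G`. -/
def auxGraph {V : Type*} (G : SimpleGraph V) (K : Set V) : SimpleGraph V where
  Adj x y := x ≠ y ∧
    ((x ∉ K ∧ y ∉ K ∧ G.Adj x y) ∨
     (x ∈ K ∧ y ∈ K ∧
        (closedNbhd G x ∪ closedNbhd G y ≠ Set.univ ∨ IsEdgeOfC4 G x y)) ∨
     (x ∈ K ∧ y ∉ K ∧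
        (¬ G.Adj x y ∨ (G.Adj x y ∧ ¬ closedNbhd G y ⊆ closedNbhd G x))) ∨
     (y ∈ K ∧ x ∉ K ∧
        (¬ G.Adj y x ∨ (G.Adj y x ∧ ¬ closedNbhd G x ⊆ closedNbhd G y))))
  symm := ⟨by
    rintro x y ⟨hne, h⟩
    refine ⟨hne.symm, ?_⟩
    rcases h with ⟨hx, hy, h⟩ | ⟨hx, hy, h⟩ | h | h
    · exact Or.inl ⟨hy, hx, h.symm⟩
    · refine Or.inr (Or.inl ⟨hy, hx, ?_⟩)
      rw [Set.union_comm]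
      exact h.imp id IsEdgeOfC4.symm
    · exact Or.inr (Or.inr (Or.inr h))
    · exact Or.inr (Or.inr (Or.inl h))⟩
  loopless := ⟨fun _ h => h.1 rfl⟩

/-- Condition `♯`: the graph `G^K` admits an interval model in which, for all `v ∈ K` and
`u ∉ K`, the interval of `v` doubly extends the interval of `u` iff `uv` is not an edge of `G`. -/
def SatisfiesSharp {V : Type*} (G : SimpleGraph V) (K : Set V) : Prop :=
  ∃ I : IntervalModel (auxGraph G K),
    ∀ v ∈ K, ∀ u ∉ K, (I.DoublyExtends v u ↔ ¬ G.Adj u v)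

end CircArc

namespace CircArc

/-! Cut the circle at a point and let `K` be the clique of vertices whose arcs contain it. Replacing
each of these arcs by its complement, an open interval `(p v, q v)`, leaves a picture on the line in
which `u ∉ K` misses `v ∈ K` exactly when `u` lies strictly inside the interval of `v`. This is
`IsFlippedModel`; it is reversible, and a model as in `♯` already is one. A flipped model need not
represent `auxGraph G K`, since the intervals of `K` may be longer than necessary. Each is shrunk to
the hull of the intervals of the non-neighbours of `v`, nonempty because `v` is not universal. The
hull contains the same intervals as before, and `disjoint_iff` and `disjoint_iff_of_mem` show that
its intersections follow the rules of `auxGraph`. A small enlargement then makes containment strict.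
-/

/-! ### Intersections of arcs, read off from lifts to the line. -/

theorem coe_unitAddCircle_eq_iff {x y : ℝ} :
    (x : UnitAddCircle) = y ↔ ∃ n : ℤ, x = y + n := by
  rw [← sub_eq_zero, ← AddCircle.coe_sub, AddCircle.coe_eq_zero_iff]
  simp only [zsmul_eq_mul, mul_one]
  exact exists_congr fun n => ⟨fun h => by linarith, fun h => by linarith⟩

theorem arc_inter_arc_nonempty_iff {a b c d : ℝ} (hab : a ≤ b) (hcd : c ≤ d) :
    (arc a b ∩ arc c d).Nonempty ↔ ∃ n : ℤ, a ≤ d + n ∧ c + n ≤ b := by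
  constructor
  · rintro ⟨_, ⟨x, ⟨hx, hx'⟩, rfl⟩, ⟨y, ⟨hy, hy'⟩, h⟩⟩
    obtain ⟨n, hn⟩ := coe_unitAddCircle_eq_iff.1 h.symm
    exact ⟨n, by linarith, by linarith⟩
  · rintro ⟨n, h, h'⟩
    refine ⟨((max a (c + n) : ℝ) : UnitAddCircle), ⟨_, ⟨le_max_left _ _, max_le hab h'⟩, rfl⟩,
      ⟨max a (c + n) - n, ⟨?_, ?_⟩, ?_⟩⟩
    · linarith [le_max_right a (c + n)]
    · linarith [max_le h (by linarith : c + n ≤ d + n)]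
    · exact coe_unitAddCircle_eq_iff.2 ⟨-n, by push_cast; ring⟩

theorem arc_add_intCast (a b : ℝ) (n : ℤ) : arc (a + n) (b + n) = arc a b := by
  ext z
  constructor
  · rintro ⟨x, ⟨h, h'⟩, rfl⟩
    exact ⟨x - n, ⟨by linarith, by linarith⟩,
      coe_unitAddCircle_eq_iff.2 ⟨-n, by push_cast; ring⟩⟩
  · rintro ⟨x, ⟨h, h'⟩, rfl⟩
    exact ⟨x + n, ⟨by linarith, by linarith⟩, coe_unitAddCircle_eq_iff.2 ⟨n, rfl⟩⟩

theorem arc_inter_arc_nonempty_iff_of_mem_Ioo {a b c d : ℝ} (hab : a ≤ b) (hcd : c ≤ d)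
    (ha : 0 < a) (hb : b < 1) (hc : 0 < c) (hd : d < 1) :
    (arc a b ∩ arc c d).Nonempty ↔ a ≤ d ∧ c ≤ b := by
  rw [arc_inter_arc_nonempty_iff hab hcd]
  constructor
  · rintro ⟨n, h, h'⟩
    have h1 : -1 < n := by exact_mod_cast (by linarith : (-1 : ℝ) < n)
    have h2 : n < 1 := by exact_mod_cast (by linarith : (n : ℝ) < 1)
    obtain rfl : n = 0 := by omega
    simpa using And.intro h h'
  · rintro ⟨h, h'⟩
    exact ⟨0, by simpa using h, by simpa using h'⟩

/-- The second arc passes through `0` and is the complement of `(p, q)`. Only its lifts `[q - 1, p]`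
and `[q, p + 1]` can reach `[a, b]`. -/
theorem arc_inter_arc_sub_one_nonempty_iff {a b p q : ℝ} (hab : a ≤ b)
    (ha : 0 < a) (hb : b < 1) (hp : 0 ≤ p) (hpq : p < q) (hq : q ≤ 1) :
    (arc a b ∩ arc (q - 1) p).Nonempty ↔ a ≤ p ∨ q ≤ b := by
  rw [arc_inter_arc_nonempty_iff hab (by linarith)]
  constructor
  · rintro ⟨n, h, h'⟩
    have h1 : -1 < n := by exact_mod_cast (by linarith : (-1 : ℝ) < n)
    have h2 : n < 2 := by exact_mod_cast (by linarith : (n : ℝ) < 2)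
    obtain rfl | rfl : n = 0 ∨ n = 1 := by omega
    · exact Or.inl (by simpa using h)
    · exact Or.inr (by simpa using h')
  · rintro (h | h)
    · exact ⟨0, by simpa using h, by push_cast; linarith⟩
    · exact ⟨1, by push_cast; linarith, by simpa using h⟩

/-! ### Circular-arc models cut open at a point. -/

/-- A circular-arc model of `G` cut open at a point of the circle: a vertex outside `K` has the
closed interval `[p u, q u]` as its arc, while the arc of a vertex of `K` contains the cut point
and is the complement of the open interval `(p v, q v)`. -/
structure IsFlippedModel {V : Type*} (G : SimpleGraph V) (K : Set V) (p q : V → ℝ) : Prop where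
  isClique : G.IsClique K
  le : ∀ v, p v ≤ q v
  lt : ∀ v ∈ K, p v < q v
  adj_iff : ∀ u ∉ K, ∀ u' ∉ K, u ≠ u' → (G.Adj u u' ↔ p u ≤ q u' ∧ p u' ≤ q u)
  not_adj_iff : ∀ v ∈ K, ∀ u ∉ K, (¬ G.Adj u v ↔ p v < p u ∧ q u < q v)

theorem IsArc.exists_of_zero_mem {S : Set UnitAddCircle} (hS : IsArc S) (h0 : 0 ∈ S) :
    ∃ p q : ℝ, 0 ≤ p ∧ p < q ∧ q ≤ 1 ∧ S = arc (q - 1) p := by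
  obtain ⟨a, b, hab, hba, rfl⟩ := hS
  obtain ⟨x, ⟨hx, hx'⟩, h⟩ := h0
  obtain ⟨n, hn⟩ := coe_unitAddCircle_eq_iff.1 (h.trans (AddCircle.coe_zero 1).symm)
  refine ⟨b - n, a - n + 1, by linarith, by linarith, by linarith, ?_⟩
  rw [← arc_add_intCast a b (-n)]
  push_cast
  congr 1
  ring

theorem IsArc.exists_of_zero_notMem {S : Set UnitAddCircle} (hS : IsArc S) (h0 : 0 ∉ S) :
    ∃ p q : ℝ, 0 < p ∧ p ≤ q ∧ q < 1 ∧ S = arc p q := by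
  obtain ⟨a, b, hab, -, rfl⟩ := hS
  have key : ∀ n : ℤ, a ≤ n → (n : ℝ) ≤ b → False := fun n h h' =>
    h0 ⟨n, ⟨h, h'⟩, (coe_unitAddCircle_eq_iff.2 ⟨n, by simp⟩).trans (AddCircle.coe_zero 1)⟩
  -- No integer lies in `[a, b]`, so this shift lands strictly inside `(0, 1)`.
  refine ⟨a - ⌊a⌋, b - ⌊a⌋, ?_, by linarith, ?_, ?_⟩
  · by_contra! h
    have := Int.floor_le a
    exact key ⌊a⌋ (by linarith) (by linarith)
  · by_contra! h
    have := Int.lt_floor_add_one a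
    exact key (⌊a⌋ + 1) (by push_cast; linarith) (by push_cast; linarith)
  · rw [← arc_add_intCast a b (-⌊a⌋)]
    push_cast
    rfl

theorem IsCircularArcGraph.exists_isFlippedModel {V : Type*} {G : SimpleGraph V}
    (h : IsCircularArcGraph G) : ∃ K p q, IsFlippedModel G K p q := by
  obtain ⟨A, hA, hadj⟩ := h
  let K : Set V := {v | 0 ∈ A v}
  have hpq : ∀ v, ∃ p q : ℝ, p ≤ q ∧ (v ∈ K → 0 ≤ p ∧ p < q ∧ q ≤ 1 ∧ A v = arc (q - 1) p) ∧
      (v ∉ K → 0 < p ∧ q < 1 ∧ A v = arc p q) := by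
    intro v
    by_cases hv : v ∈ K
    · obtain ⟨p, q, h⟩ := (hA v).exists_of_zero_mem hv
      exact ⟨p, q, h.2.1.le, fun _ => h, fun hv' => absurd hv hv'⟩
    · obtain ⟨p, q, h1, h2, h3⟩ := (hA v).exists_of_zero_notMem hv
      exact ⟨p, q, h2, fun hv' => absurd hv' hv, fun _ => ⟨h1, h3⟩⟩
  choose p q hle hK hnK using hpq
  refine ⟨K, p, q, ?_, hle, fun v hv => (hK v hv).2.1, ?_, ?_⟩
  · exact fun v hv v' hv' hne => (hadj v v' hne).2 ⟨0, hv, hv'⟩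
  · intro u hu u' hu' hne
    obtain ⟨h1, h2, h3⟩ := hnK u hu
    obtain ⟨h1', h2', h3'⟩ := hnK u' hu'
    rw [hadj u u' hne, h3, h3',
      arc_inter_arc_nonempty_iff_of_mem_Ioo (hle u) (hle u') h1 h2 h1' h2']
  · intro v hv u hu
    obtain ⟨h1, h2, h3⟩ := hnK u hu
    obtain ⟨h1', h2', h3', h4'⟩ := hK v hv
    rw [hadj u v (fun h => hu (h ▸ hv)), h3, h4',
      arc_inter_arc_sub_one_nonempty_iff (hle u) h1 h2 h1' h2' h3']
    push Not
    rfl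

theorem IsFlippedModel.isCircularArcGraph {V : Type*} {G : SimpleGraph V} {K : Set V}
    {p q : V → ℝ} (h : IsFlippedModel G K p q) : IsCircularArcGraph G := by
  classical
  -- A strictly increasing map of the line into `(0, 1)` keeps the order of all endpoints and leaves
  -- `0` free as the cut point.
  let f := Real.sigmoid
  have f0 : ∀ x, 0 < f x := Real.sigmoid_pos
  have f1 : ∀ x, f x < 1 := Real.sigmoid_lt_one
  have zero_mem : ∀ v, (0 : UnitAddCircle) ∈ arc (f (q v) - 1) (f (p v)) := fun v =>
    ⟨0, ⟨by linarith [f1 (q v)], (f0 _).le⟩, AddCircle.coe_zero 1⟩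
  have mixed : ∀ v ∈ K, ∀ u ∉ K, (G.Adj u v ↔
      (arc (f (p u)) (f (q u)) ∩ arc (f (q v) - 1) (f (p v))).Nonempty) := by
    intro v hv u hu
    rw [arc_inter_arc_sub_one_nonempty_iff (Real.sigmoid_le (h.le u)) (f0 _) (f1 _) (f0 _).le
      (Real.sigmoid_lt (h.lt v hv)) (f1 _).le, Real.sigmoid_le_iff, Real.sigmoid_le_iff,
      ← not_iff_not, h.not_adj_iff v hv u hu]
    push Not
    rfl
  refine ⟨fun v => if v ∈ K then arc (f (q v) - 1) (f (p v)) else arc (f (p v)) (f (q v)),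
    fun v => ?_, fun u v hne => ?_⟩
  · dsimp only
    split_ifs with hv
    · have := Real.sigmoid_lt (h.lt v hv)
      exact ⟨_, _, by linarith [f0 (p v), f1 (q v)], by linarith, rfl⟩
    · exact ⟨_, _, Real.sigmoid_le (h.le v), by linarith [f0 (p v), f1 (q v)], rfl⟩
  · dsimp only
    split_ifs with hu hv hv
    · exact iff_of_true (h.isClique hu hv hne) ⟨0, zero_mem u, zero_mem v⟩
    · rw [G.adj_comm, Set.inter_comm]
      exact mixed u hu v hv
    · exact mixed v hv u hu
    · rw [arc_inter_arc_nonempty_iff_of_mem_Ioo (Real.sigmoid_le (h.le u))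
        (Real.sigmoid_le (h.le v)) (f0 _) (f1 _) (f0 _) (f1 _), Real.sigmoid_le_iff,
        Real.sigmoid_le_iff, h.adj_iff u hu v hv hne]

/-! ### From interval models with `♯` to flipped models. -/

theorem Icc_inter_Icc_nonempty_iff {a b c d : ℝ} (hab : a ≤ b) (hcd : c ≤ d) :
    (Set.Icc a b ∩ Set.Icc c d).Nonempty ↔ a ≤ d ∧ c ≤ b := by
  rw [Set.Icc_inter_Icc, Set.nonempty_Icc, sup_le_iff, le_inf_iff, le_inf_iff]
  tauto

theorem exists_notMem_not_adj {V : Type*} {G : SimpleGraph V} (hG : ∀ v, ¬ G.IsUniversal v)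
    {K : Set V} (hK : G.IsClique K) {v : V} (hv : v ∈ K) : ∃ u ∉ K, ¬ G.Adj u v := by
  have := hG v
  simp only [SimpleGraph.IsUniversal, not_forall] at this
  obtain ⟨u, hne, hu⟩ := this
  exact ⟨u, fun h => hu (hK hv h hne), fun h => hu h.symm⟩

/-- Only the edges outside `K` and the double extensions matter; the edges of `auxGraph G K` that
meet `K` play no role. -/
theorem SatisfiesSharp.exists_isFlippedModel {V : Type*} {G : SimpleGraph V}
    (hG : ∀ v, ¬ G.IsUniversal v) {K : Set V} (hK : G.IsClique K) (h : SatisfiesSharp G K) :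
    ∃ p q, IsFlippedModel G K p q := by
  obtain ⟨I, hI⟩ := h
  refine ⟨I.lp, I.rp, hK, I.lp_le_rp, fun v hv => ?_, fun u hu u' hu' hne => ?_,
    fun v hv u hu => ?_⟩
  -- The interval of `v` doubly extends that of a non-neighbour, so it is not a point.
  · obtain ⟨u, hu, huv⟩ := exists_notMem_not_adj hG hK hv
    obtain ⟨h1, h2, h3⟩ := (hI v hv u hu).2 huv
    linarith
  · rw [← Icc_inter_Icc_nonempty_iff (I.lp_le_rp u) (I.lp_le_rp u'), ← I.adj_iff u u' hne]
    simp [auxGraph, hu, hu', hne]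
  · rw [← hI v hv u hu]
    exact ⟨fun h => ⟨h.1, h.2.2⟩, fun h => ⟨h.1, I.lp_le_rp u, h.2⟩⟩

theorem exists_pos_add_two_mul_lt {ι : Type*} [Finite ι] (f : ι → ℝ) :
    ∃ ε > 0, ∀ i j, f i < f j → f i + 2 * ε < f j := by
  have : ∀ᶠ ε in nhdsWithin (0 : ℝ) (Set.Ioi 0), ∀ i j, f i < f j → f i + 2 * ε < f j := by
    refine Filter.eventually_all.2 fun i => Filter.eventually_all.2 fun j => ?_
    by_cases h : f i < f j
    · filter_upwards [Ioo_mem_nhdsGT (show (0 : ℝ) < (f j - f i) / 2 by linarith)] with ε hε _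
      linarith [hε.2]
    · exact Filter.Eventually.of_forall fun _ h' => absurd h' h
  obtain ⟨ε, h, h0⟩ := (this.and self_mem_nhdsWithin).exists
  exact ⟨ε, h0, h⟩

theorem mem_closedNbhd {V : Type*} {G : SimpleGraph V} {v w : V} :
    w ∈ closedNbhd G v ↔ w = v ∨ G.Adj v w := by
  simp [closedNbhd]

/-! ### Hulls of non-neighbours and the model of `auxGraph G K`. -/

section Hull

variable {V : Type*} {G : SimpleGraph V} {K : Set V} {p q : V → ℝ}

/-- `x v` and `y v` are vertices realising the left and the right end of the convex hull of the
intervals of the non-neighbours of `v ∈ K`. -/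
structure IsNonNbrHull (G : SimpleGraph V) (K : Set V) (p q : V → ℝ) (x y : V → V) : Prop where
  notMem_left : ∀ v ∈ K, x v ∉ K
  notMem_right : ∀ v ∈ K, y v ∉ K
  not_adj_left : ∀ v ∈ K, ¬ G.Adj (x v) v
  not_adj_right : ∀ v ∈ K, ¬ G.Adj (y v) v
  left_le : ∀ v ∈ K, ∀ u ∉ K, ¬ G.Adj u v → p (x v) ≤ p u
  le_right : ∀ v ∈ K, ∀ u ∉ K, ¬ G.Adj u v → q u ≤ q (y v)

theorem exists_isNonNbrHull [Finite V] (hG : ∀ v, ¬ G.IsUniversal v) (hK : G.IsClique K)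
    (p q : V → ℝ) : ∃ x y, IsNonNbrHull G K p q x y := by
  have key : ∀ v, ∃ x y, v ∈ K → (x ∉ K ∧ ¬ G.Adj x v) ∧ (y ∉ K ∧ ¬ G.Adj y v) ∧
      ∀ u ∉ K, ¬ G.Adj u v → p x ≤ p u ∧ q u ≤ q y := by
    intro v
    by_cases hv : v ∈ K
    · have hne : {u | u ∉ K ∧ ¬ G.Adj u v}.Nonempty := exists_notMem_not_adj hG hK hv
      obtain ⟨x, hx, hx'⟩ := Set.exists_min_image _ p (Set.toFinite _) hne
      obtain ⟨y, hy, hy'⟩ := Set.exists_max_image _ q (Set.toFinite _) hne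
      exact ⟨x, y, fun _ => ⟨hx, hy, fun u hu hu' => ⟨hx' u ⟨hu, hu'⟩, hy' u ⟨hu, hu'⟩⟩⟩⟩
    · exact ⟨v, v, fun h => absurd h hv⟩
  choose x y h using key
  exact ⟨x, y, fun v hv => (h v hv).1.1, fun v hv => (h v hv).2.1.1, fun v hv => (h v hv).1.2,
    fun v hv => (h v hv).2.1.2, fun v hv u hu hu' => ((h v hv).2.2 u hu hu').1,
    fun v hv u hu hu' => ((h v hv).2.2 u hu hu').2⟩

variable {x y : V → V}

/-- The hull lies strictly inside `(p v, q v)`, so any interval it contains belongs to a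
non-neighbour. -/
theorem IsNonNbrHull.not_adj_iff (h : IsFlippedModel G K p q) (hx : IsNonNbrHull G K p q x y)
    {v u : V} (hv : v ∈ K) (hu : u ∉ K) :
    ¬ G.Adj u v ↔ p (x v) ≤ p u ∧ q u ≤ q (y v) := by
  refine ⟨fun h' => ⟨hx.left_le v hv u hu h', hx.le_right v hv u hu h'⟩, fun h' => ?_⟩
  rw [h.not_adj_iff v hv u hu]
  have h1 := (h.not_adj_iff v hv _ (hx.notMem_left v hv)).1 (hx.not_adj_left v hv)
  have h2 := (h.not_adj_iff v hv _ (hx.notMem_right v hv)).1 (hx.not_adj_right v hv)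
  exact ⟨h1.1.trans_le h'.1, h'.2.trans_lt h2.2⟩

theorem IsNonNbrHull.left_le_right (h : IsFlippedModel G K p q)
    (hx : IsNonNbrHull G K p q x y) {v : V} (hv : v ∈ K) : p (x v) ≤ q (y v) :=
  (h.le _).trans (hx.le_right v hv _ (hx.notMem_left v hv) (hx.not_adj_left v hv))

theorem IsFlippedModel.separated (h : IsFlippedModel G K p q) {u w : V} (hu : u ∉ K)
    (hw : w ∉ K) (hne : u ≠ w) (huw : ¬ G.Adj u w) : q u < p w ∨ q w < p u := by
  rw [h.adj_iff u hu w hw hne] at huw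
  by_contra! hc
  exact huw ⟨hc.2, hc.1⟩

theorem notMem_of_not_adj (hK : G.IsClique K) {v w : V} (hv : v ∈ K) (hne : w ≠ v)
    (hw : ¬ G.Adj v w) : w ∉ K := fun hwK => hw (hK hv hwK hne.symm)

/-- The hull of the non-neighbours of `v` misses the interval of `u` exactly when `u` is
dominated by `v`. -/
theorem IsNonNbrHull.disjoint_iff (h : IsFlippedModel G K p q)
    (hx : IsNonNbrHull G K p q x y) {v u : V} (hv : v ∈ K) (hu : u ∉ K) :
    ¬ (p (x v) ≤ q u ∧ p u ≤ q (y v)) ↔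
      G.Adj v u ∧ closedNbhd G u ⊆ closedNbhd G v := by
  constructor
  · intro hd
    have hvu : G.Adj v u := by
      by_contra hvu
      have := (hx.not_adj_iff h hv hu).1 (fun h' => hvu h'.symm)
      exact hd ⟨this.1.trans (h.le u), (h.le u).trans this.2⟩
    refine ⟨hvu, fun w hw => ?_⟩
    rw [mem_closedNbhd] at hw ⊢
    by_contra! hc
    rcases hw with rfl | hw
    · exact hc.2 hvu
    have hwK := notMem_of_not_adj h.isClique hv hc.1 hc.2
    have h1 := (hx.not_adj_iff h hv hwK).1 (fun h' => hc.2 h'.symm)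
    have h2 := (h.adj_iff u hu w hwK hw.ne).1 hw
    exact hd ⟨h1.1.trans h2.2, h2.1.trans h1.2⟩
  · rintro ⟨hvu, hsub⟩ ⟨h1, h2⟩
    -- By domination `u` misses every non-neighbour of `v`. If `u` met the hull, it would lie
    -- between `x v` and `y v`, hence inside the hull, and be a non-neighbour itself.
    have far : ∀ w ∉ K, ¬ G.Adj w v → q u < p w ∨ q w < p u := by
      intro w hw hwv
      have hne : u ≠ w := by
        rintro rfl
        exact hwv hvu.symm
      refine h.separated hu hw hne fun huw => ?_
      rcases mem_closedNbhd.1 (hsub (mem_closedNbhd.2 (Or.inr huw))) with rfl | h'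
      · exact hw hv
      · exact hwv h'.symm
    have hx' := far _ (hx.notMem_left v hv) (hx.not_adj_left v hv)
    have hy' := far _ (hx.notMem_right v hv) (hx.not_adj_right v hv)
    have := h.le (x v)
    have := h.le (y v)
    refine (hx.not_adj_iff h hv hu).2 ⟨?_, ?_⟩ hvu.symm
    · rcases hx' with h' | h' <;> linarith
    · rcases hy' with h' | h' <;> linarith

/-- The hulls of the non-neighbours of `v` and `v'` are disjoint exactly when `v` and `v'`
together dominate the graph and `vv'` is not an edge of an induced four-cycle. -/
theorem IsNonNbrHull.disjoint_iff_of_mem (h : IsFlippedModel G K p q)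
    (hx : IsNonNbrHull G K p q x y) {v v' : V} (hv : v ∈ K) (hv' : v' ∈ K) (hne : v ≠ v') :
    (p (x v) ≤ q (y v') ∧ p (x v') ≤ q (y v)) ↔
      (closedNbhd G v ∪ closedNbhd G v' ≠ Set.univ ∨ IsEdgeOfC4 G v v') := by
  constructor
  · rintro ⟨h1, h2⟩
    by_contra! hc
    obtain ⟨hcov, hC4⟩ := hc
    have cov : ∀ w ∉ K, ¬ G.Adj w v → ¬ G.Adj w v' → False := by
      intro w hw hwv hwv'
      have : w ∈ closedNbhd G v ∪ closedNbhd G v' := hcov ▸ Set.mem_univ w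
      rcases this with this | this <;> rcases mem_closedNbhd.1 this with rfl | h'
      · exact hw hv
      · exact hwv h'.symm
      · exact hw hv'
      · exact hwv' h'.symm
    -- Adjacent non-neighbours `w` of `v` and `w'` of `v'` would close the induced cycle `v v' w
    -- w'`.
    have far : ∀ w ∉ K, ¬ G.Adj w v → ∀ w' ∉ K, ¬ G.Adj w' v' → q w < p w' ∨ q w' < p w := by
      intro w hw hwv w' hw' hwv'
      have hww' : w ≠ w' := by
        rintro rfl
        exact cov w hw hwv hwv'
      refine h.separated hw hw' hww' fun hadj => hC4 ⟨w, w', ?_, ?_, h.isClique hv hv' hne,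
        ?_, hadj, ?_, fun h' => hwv h'.symm, fun h' => hwv' h'.symm⟩
      · rintro rfl
        exact hw hv
      · rintro rfl
        exact hw' hv'
      · exact (not_not.1 (cov w hw hwv)).symm
      · exact not_not.1 fun h' => cov w' hw' h' hwv'
    have hxK := hx.notMem_left v hv
    have hxK' := hx.notMem_left v' hv'
    have hyK := hx.notMem_right v hv
    have hyK' := hx.notMem_right v' hv'
    have hxa := hx.not_adj_left v hv
    have hxa' := hx.not_adj_left v' hv'
    have hya := hx.not_adj_right v hv
    have hya' := hx.not_adj_right v' hv'
    have l1 := h.le (x v)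
    have l2 := h.le (x v')
    have l3 := h.le (y v)
    have l4 := h.le (y v')
    have A : q (x v) < p (y v') := by
      rcases far _ hxK hxa _ hyK' hya' with h' | h' <;> linarith
    have B : q (x v') < p (y v) := by
      rcases far _ hyK hya _ hxK' hxa' with h' | h' <;> linarith
    -- Whichever of `y v`, `y v'` is further left lies in both hulls, so neither `v` nor `v'`
    -- dominates it.
    rcases far _ hyK hya _ hyK' hya' with h' | h'
    · exact cov _ hyK hya ((hx.not_adj_iff h hv' hyK).2 ⟨by linarith, by linarith⟩)
    · exact cov _ hyK' ((hx.not_adj_iff h hv hyK').2 ⟨by linarith, by linarith⟩) hya'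
  · rintro (hcov | ⟨w, w', h1, h2, -, h4, h5, h6, h7, h8⟩)
    · obtain ⟨w, hw⟩ := (Set.ne_univ_iff_exists_notMem _).1 hcov
      simp only [Set.mem_union, mem_closedNbhd, not_or] at hw
      obtain ⟨⟨a1, a2⟩, a3, a4⟩ := hw
      have hwK := notMem_of_not_adj h.isClique hv a1 a2
      have b1 := (hx.not_adj_iff h hv hwK).1 (fun h' => a2 h'.symm)
      have b2 := (hx.not_adj_iff h hv' hwK).1 (fun h' => a4 h'.symm)
      have := h.le w
      exact ⟨by linarith, by linarith⟩
    · have hwK := notMem_of_not_adj h.isClique hv h1.symm h7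
      have hwK' := notMem_of_not_adj h.isClique hv' h2.symm h8
      have b1 := (hx.not_adj_iff h hv hwK).1 (fun h' => h7 h'.symm)
      have b2 := (hx.not_adj_iff h hv' hwK').1 (fun h' => h8 h'.symm)
      have b3 := (h.adj_iff w hwK w' hwK' h5.ne).1 h5
      exact ⟨by linarith, by linarith⟩

theorem IsFlippedModel.satisfiesSharp [Finite V] (hG : ∀ v, ¬ G.IsUniversal v)
    (h : IsFlippedModel G K p q) : SatisfiesSharp G K := by
  classical
  obtain ⟨x, y, hx⟩ := exists_isNonNbrHull hG h.isClique p q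
  -- Two enlarged hulls approach each other by `2 * ε`, which must stay below every positive gap
  -- between endpoints.
  obtain ⟨ε, hε, hgap⟩ := exists_pos_add_two_mul_lt (Sum.elim p q)
  have gap_pp : ∀ u w, p u < p w → p u + 2 * ε < p w := fun u w => hgap (.inl u) (.inl w)
  have gap_qq : ∀ u w, q u < q w → q u + 2 * ε < q w := fun u w => hgap (.inr u) (.inr w)
  have gap_qp : ∀ u w, q u < p w → q u + 2 * ε < p w := fun u w => hgap (.inr u) (.inl w)
  let l : V → ℝ := fun v => if v ∈ K then p (x v) - ε else p v
  let r : V → ℝ := fun v => if v ∈ K then q (y v) + ε else q v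
  have hlr : ∀ v, l v ≤ r v := by
    intro v
    by_cases hv : v ∈ K
    · have := hx.left_le_right h hv
      simp only [l, r, hv, if_true]
      linarith
    · simpa [l, r, hv] using h.le v
  have mixed : ∀ v ∈ K, ∀ u ∉ K, ((l v ≤ r u ∧ l u ≤ r v) ↔
      (¬ G.Adj v u ∨ (G.Adj v u ∧ ¬ closedNbhd G u ⊆ closedNbhd G v))) := by
    intro v hv u hu
    have h1 : (l v ≤ r u ∧ l u ≤ r v) ↔ (p (x v) ≤ q u ∧ p u ≤ q (y v)) := by
      simp only [l, r, hv, hu, if_true, if_false]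
      refine and_congr ⟨fun h' => ?_, fun h' => by linarith⟩ ⟨fun h' => ?_, fun h' => by linarith⟩
      · by_contra! hc
        linarith [gap_qp _ _ hc]
      · by_contra! hc
        linarith [gap_qp _ _ hc]
    rw [h1, ← not_iff_not, hx.disjoint_iff h hv hu]
    by_cases hvu : G.Adj v u <;> simp [hvu]
  have adj : ∀ u v, u ≠ v → ((auxGraph G K).Adj u v ↔ (l u ≤ r v ∧ l v ≤ r u)) := by
    intro u v hne
    by_cases hu : u ∈ K <;> by_cases hv : v ∈ K
    · have h1 : (l u ≤ r v ∧ l v ≤ r u) ↔ (p (x u) ≤ q (y v) ∧ p (x v) ≤ q (y u)) := by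
        simp only [l, r, hv, hu, if_true]
        refine and_congr ⟨fun h' => ?_, fun h' => by linarith⟩
          ⟨fun h' => ?_, fun h' => by linarith⟩
        · by_contra! hc
          linarith [gap_qp _ _ hc]
        · by_contra! hc
          linarith [gap_qp _ _ hc]
      rw [h1, hx.disjoint_iff_of_mem h hu hv hne]
      simp [auxGraph, hne, hu, hv]
    · rw [mixed u hu v hv]
      simp only [auxGraph, hu, hv]
      tauto
    · rw [and_comm, mixed v hv u hu]
      simp only [auxGraph, hu, hv]
      tauto
    · have : (l u ≤ r v ∧ l v ≤ r u) ↔ (p u ≤ q v ∧ p v ≤ q u) := by simp [l, r, hu, hv]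
      rw [this, ← h.adj_iff u hu v hv hne]
      simp [auxGraph, hne, hu, hv]
  refine ⟨⟨l, r, hlr, fun u v hne => ?_⟩, fun v hv u hu => ?_⟩
  · rw [adj u v hne, Icc_inter_Icc_nonempty_iff (hlr u) (hlr v)]
  · simp only [IntervalModel.DoublyExtends, hx.not_adj_iff h hv hu, l, r, hv, hu, if_true,
      if_false]
    constructor
    · rintro ⟨h1, -, h2⟩
      constructor
      · by_contra! hc
        linarith [gap_pp _ _ hc]
      · by_contra! hc
        linarith [gap_qq _ _ hc]
    · rintro ⟨h1, h2⟩
      exact ⟨by linarith, h.le u, by linarith⟩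

end Hull

end CircArc

theorem theorem2 {V : Type*} [Finite V] (G : SimpleGraph V)
    (hG : ∀ v : V, ¬ G.IsUniversal v) :
    CircArc.IsCircularArcGraph G ↔
      ∃ K : Set V, G.IsClique K ∧ CircArc.SatisfiesSharp G K := by
  constructor
  · intro h
    obtain ⟨K, p, q, hpq⟩ := h.exists_isFlippedModel
    exact ⟨K, hpq.isClique, hpq.satisfiesSharp hG⟩
  · rintro ⟨K, hK, h⟩
    obtain ⟨p, q, hpq⟩ := h.exists_isFlippedModel hG hK
    exact hpq.isCircularArcGraph
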